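/- Let $(\Omega,\mathcal F,P)$ be a probability space and let $L^0$ be the space of real random variables modulo almost sure equality, with the almost sure order. Let $\mathcal X$ be either $L^\infty$ with the weak-star topology $\sigma(L^\infty,L^1)$, or a linear subspace of $L^0$ with a topology making it a Fréchet lattice (a completely metrizable, locally solid Riesz space) such that: (a) $X_n\downarrow 0$ a.s. in $\mathcal X$ implies $X_n\to 0$ in $\mathcal X$; (b) $L^\infty\subset\mathcal X\subset L^0$ with dense, continuous inclusions, where $L^\infty$ carries the norm topology and $L^0$ the topology of convergence in probability; (c) $1_AX\in\mathcal X$ for all $X\in\mathcal X$ and $A\in\mathcal F$. No local convexity of $\mathcal X$ is assumed (so that, for instance, $\mathcal X=L^p$ with $0\le p<1$ is allowed). An acceptance set is a nonempty, strict subset $\mathcal A\subset\mathcal X$ such that $X\in\mathcal A$, $Y\in\mathcal X$, $Y\ge X$ imply $Y\in\mathcal A$. It is surplus invariant if $X\in\mathcal A$, $Y\in\mathcal X$, $Y^-\le X^-$ imply $Y\in\mathcal A$, where $X^-=\max\{-X,0\}$. A decreasing floor function is a map $\varphi:L^\infty_+\to\mathbb R\cup\{-\infty\}$ with $\varphi\le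 0$, with $\varphi(Z)>-\infty$ for some $Z$, and with $\varphi(Z_1)\ge\varphi(Z_2)$ whenever $Z_1\le Z_2$. Write $\mathcal A^\infty=\mathcal A\cap L^\infty$ and $\sigma_{\mathcal A^\infty}(Z)=\inf_{X\in\mathcal A^\infty}E[XZ]$ for $Z\in L^1$. Theorem. Let $\mathcal A\subset\mathcal X$ be a closed, convex, surplus-invariant acceptance set. Then there exists a decreasing floor function $\varphi$ such that $$\mathcal A=\bigcap_{Z\in L^\infty_+}\{X\in\mathcal X:\ -E[X^-Z]\ge\varphi(Z)\},\qquad(*)$$ where $-E[X^-Z]=-\infty$ if $X^-Z$ is not integrable. For $\varphi$ one can always choose the restriction of $\sigma_{\mathcal A^\infty}$ to $L^\infty_+$, which is a decreasing floor function satisfying $(*)$. Moreover, $\sigma_{\mathcal A^\infty}\ge\varphi$ on $L^\infty_+$ for every decreasing floor function $\varphi$ satisfying $(*)$. -/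

import Mathlib

open MeasureTheory Filter Topology
open scoped ENNReal

/-- The space `L⁰` of real random variables modulo almost sure equality. -/
abbrev RV {Ω : Type*} [MeasurableSpace Ω] (P : Measure Ω) : Type _ := Ω →ₘ[P] ℝ

/-- The random variable `1_A X`. -/
noncomputable def localize {Ω : Type*} [MeasurableSpace Ω] {P : Measure Ω}
    (A : Set Ω) (hA : MeasurableSet A) (X : RV P) : RV P :=
  AEEqFun.mk (A.indicator X) (X.aestronglyMeasurable.indicator hA)

/-- The initial topology on `𝒳` for the maps `X ↦ E[XZ]`, `Z ∈ L¹`. It is used only for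
`𝒳 = L^∞`, where it is the weak-star topology `σ(L^∞, L¹)`. -/
@[reducible] noncomputable def weakStarTopology {Ω : Type*} [MeasurableSpace Ω] (P : Measure Ω)
    (𝒳 : Submodule ℝ (RV P)) : TopologicalSpace 𝒳 :=
  TopologicalSpace.induced
    (fun (X : 𝒳) (Z : Lp ℝ 1 P) => ∫ ω, (X : RV P) ω * Z ω ∂P) inferInstance

/-- A linear subspace `𝒳` of `L⁰`, with a topology making it a Fréchet lattice (a completely
metrizable, locally solid Riesz space; no local convexity is required), with the `σ`-Lebesgue
property, dense continuous embeddings `L^∞ ↪ 𝒳 ↪ L⁰` and the localization property.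
The order is the almost sure order of `L⁰`. That `𝒳` is closed under the lattice operations follows
from the localization property, see `IsFrechetAmbient.sup_mem`. -/
structure IsFrechetAmbient {Ω : Type*} [MeasurableSpace Ω] (P : Measure Ω)
    (𝒳 : Submodule ℝ (RV P)) [TopologicalSpace 𝒳] : Prop where
  topologicalAddGroup : IsTopologicalAddGroup 𝒳
  continuousSMul : ContinuousSMul ℝ 𝒳
  completelyMetrizable : TopologicalSpace.IsCompletelyMetrizableSpace 𝒳
  /-- The solid neighbourhoods of zero form a base of the neighbourhoods of zero. -/
  locallySolid : ∀ U ∈ 𝓝 (0 : 𝒳), ∃ V ∈ 𝓝 (0 : 𝒳), V ⊆ U ∧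
    ∀ X ∈ V, ∀ Y : 𝒳, |(Y : RV P)| ≤ |(X : RV P)| → Y ∈ V
  sigmaLebesgue : ∀ u : ℕ → 𝒳, Antitone (fun n => (u n : RV P)) →
    (∀ᵐ ω ∂P, Tendsto (fun n => (u n : RV P) ω) atTop (𝓝 0)) → Tendsto u atTop (𝓝 0)
  linfty_mem : ∀ X : Lp ℝ ∞ P, (X : RV P) ∈ 𝒳
  /-- The inclusion of `L^∞`, with the norm topology, is continuous. -/
  linfty_continuous : Continuous (fun X : Lp ℝ ∞ P => (⟨X, linfty_mem X⟩ : 𝒳))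
  linfty_dense : DenseRange (fun X : Lp ℝ ∞ P => (⟨X, linfty_mem X⟩ : 𝒳))
  /-- The inclusion into `L⁰`, with the topology of convergence in probability, is continuous. -/
  l0_continuous : ∀ X₀ : 𝒳,
    TendstoInMeasure P (fun (X : 𝒳) => ((X : RV P) : Ω → ℝ)) (𝓝 X₀) (X₀ : RV P)
  l0_dense : ∀ Y : RV P, ∃ u : ℕ → 𝒳,
    TendstoInMeasure P (fun n => ((u n : RV P) : Ω → ℝ)) atTop Y
  localization : ∀ (A : Set Ω) (hA : MeasurableSet A), ∀ X ∈ 𝒳, localize A hA X ∈ 𝒳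

theorem IsFrechetAmbient.sup_mem {Ω : Type*} [MeasurableSpace Ω] {P : Measure Ω}
    {𝒳 : Submodule ℝ (RV P)} [TopologicalSpace 𝒳] (h : IsFrechetAmbient P 𝒳)
    {X Y : RV P} (hX : X ∈ 𝒳) (hY : Y ∈ 𝒳) : X ⊔ Y ∈ 𝒳 := by
  have hA : MeasurableSet {ω | 0 ≤ (X - Y) ω} :=
    measurableSet_le measurable_const (X - Y).measurable
  have e : X ⊔ Y = Y + localize {ω | 0 ≤ (X - Y) ω} hA (X - Y) := by
    apply AEEqFun.ext
    filter_upwards [AEEqFun.coeFn_sup X Y, AEEqFun.coeFn_sub X Y,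
      AEEqFun.coeFn_add Y (localize {ω | 0 ≤ (X - Y) ω} hA (X - Y)),
      AEEqFun.coeFn_mk (Set.indicator {ω | 0 ≤ (X - Y) ω} (X - Y))
        ((X - Y).aestronglyMeasurable.indicator hA)] with ω h1 h2 h3 h4
    rw [h1, h3]
    simp only [Pi.add_apply, localize]
    rw [h4]
    simp only [Set.indicator_apply, Set.mem_ofPred_eq, h2, Pi.sub_apply]
    split_ifs with hc
    · rw [sup_eq_left.2 (by linarith)]; ring
    · rw [sup_eq_right.2 (by linarith)]; ring
  rw [e]
  exact 𝒳.add_mem hY (h.localization _ hA _ (𝒳.sub_mem hX hY))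

/-- The admissible ambient spaces: `L^∞` with the weak-star topology, or a Fréchet lattice of
random variables as above. -/
def IsAmbient {Ω : Type*} [MeasurableSpace Ω] (P : Measure Ω)
    (𝒳 : Submodule ℝ (RV P)) [τ : TopologicalSpace 𝒳] : Prop :=
  (𝒳 = Lp.LpSubmodule ℝ ℝ ∞ P ∧ τ = weakStarTopology P 𝒳) ∨ IsFrechetAmbient P 𝒳

/-- An acceptance set: a nonempty, strict, monotone subset of `𝒳`. -/
structure IsAcceptanceSet {Ω : Type*} [MeasurableSpace Ω] {P : Measure Ω}
    {𝒳 : Submodule ℝ (RV P)} (𝒜 : Set 𝒳) : Prop where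
  nonempty : 𝒜.Nonempty
  ne_univ : 𝒜 ≠ Set.univ
  monotone : ∀ X ∈ 𝒜, ∀ Y : 𝒳, (X : RV P) ≤ (Y : RV P) → Y ∈ 𝒜

/-- Surplus invariance: acceptability depends only on the negative part `X⁻ = max(-X, 0)`,
and a smaller negative part stays acceptable. -/
def SurplusInvariant {Ω : Type*} [MeasurableSpace Ω] {P : Measure Ω}
    {𝒳 : Submodule ℝ (RV P)} (𝒜 : Set 𝒳) : Prop :=
  ∀ X ∈ 𝒜, ∀ Y : 𝒳, (-(Y : RV P)) ⊔ 0 ≤ (-(X : RV P)) ⊔ 0 → Y ∈ 𝒜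

/-- `𝒜^∞ = 𝒜 ∩ L^∞`. -/
def boundedPart {Ω : Type*} [MeasurableSpace Ω] {P : Measure Ω}
    {𝒳 : Submodule ℝ (RV P)} (𝒜 : Set 𝒳) : Set (Lp ℝ ∞ P) :=
  {X | ∃ hX : (X : RV P) ∈ 𝒳, (⟨X, hX⟩ : 𝒳) ∈ 𝒜}

/-- The lower support function `σ_C(Z) = inf_{X ∈ C} E[XZ]` of `C ⊆ L^∞`, for `Z ∈ L¹`. -/
noncomputable def lowerSupport {Ω : Type*} [MeasurableSpace Ω] {P : Measure Ω}
    (C : Set (Lp ℝ ∞ P)) (Z : Lp ℝ 1 P) : EReal :=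
  ⨅ X ∈ C, ((∫ ω, X ω * Z ω ∂P : ℝ) : EReal)

/-- The positive cone `L^∞_+`, with the almost sure order. -/
abbrev LinftyPos {Ω : Type*} [MeasurableSpace Ω] (P : Measure Ω) : Type _ :=
  {Z : Lp ℝ ∞ P // 0 ≤ Z}

/-- The inclusion of `L^∞_+` into `L¹`. -/
def LinftyPos.toL1 {Ω : Type*} [MeasurableSpace Ω] {P : Measure Ω} [IsProbabilityMeasure P]
    (Z : LinftyPos P) : Lp ℝ 1 P :=
  ⟨(Z.1 : RV P), Lp.antitone le_top Z.1.2⟩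

/-- Decreasing floor functions `φ : L^∞_+ → ℝ ∪ {-∞}`; the value `+∞` of `EReal` is excluded
by `nonpos`. -/
structure IsDecreasingFloor {Ω : Type*} [MeasurableSpace Ω] {P : Measure Ω}
    (φ : LinftyPos P → EReal) : Prop where
  nonpos : ∀ Z, φ Z ≤ 0
  exists_ne_bot : ∃ Z, ⊥ < φ Z
  decreasing : Antitone φ

/-- `-E[X⁻ Z]` for `Z ≥ 0`; it equals `-∞` if `X⁻ Z` is not integrable. -/
noncomputable def negExpectation {Ω : Type*} [MeasurableSpace Ω] {P : Measure Ω}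
    (X : RV P) (Z : LinftyPos P) : EReal :=
  -((∫⁻ ω, ENNReal.ofReal (max (-(X ω)) 0 * Z.1 ω) ∂P : ℝ≥0∞) : EReal)

/-- `φ` represents `𝒜`: `𝒜 = ⋂_{Z ∈ L^∞_+} {X ∈ 𝒳 : -E[X⁻ Z] ≥ φ(Z)}`. -/
def Represents {Ω : Type*} [MeasurableSpace Ω] {P : Measure Ω}
    {𝒳 : Submodule ℝ (RV P)} (φ : LinftyPos P → EReal) (𝒜 : Set 𝒳) : Prop :=
  𝒜 = ⋂ Z : LinftyPos P, {X : 𝒳 | φ Z ≤ negExpectation (X : RV P) Z}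

/-! ### Order properties shared by the two kinds of ambient space. -/

section Ambient

variable {Ω : Type*} [MeasurableSpace Ω] {P : Measure Ω} {𝒳 : Submodule ℝ (RV P)}
  [TopologicalSpace 𝒳]

/-! The topology of `𝒳` enters only through one fact: almost surely decreasing sequences converge to
their limits, so a closed `𝒜` contains decreasing limits of its bounded elements
(`mem_of_antitone_boundedPart`). With surplus invariance this replaces local convexity.

Separation takes place in the Hilbert space `L²`. If bounded elements of `𝒜` converge in `L²` to `Y
≤ 0`, tail infima of their negative parts along an a.s. convergent subsequence give elements of `𝒜`
decreasing to `Y`, so `Y ∈ 𝒜` (`mem_boundedPart_of_mem_closure`). Hence a bounded `Y ≤ 0` outside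
`𝒜` is strictly separated by some `Z ∈ L²`. Surplus invariance allows `Z` to be replaced by `min(Z⁺,
k) ∈ L^∞_+` (`le_lowerSupport_truncPosPart`), and the separation survives for large `k`.

Unbounded `X` are reached through `-min(X⁻, n)`, which decreases to `min(X, 0)`. Maximality of the
support function follows from `-E[X⁻Z] ≤ E[XZ]`. -/

theorem IsAmbient.linfty_mem (h : IsAmbient P 𝒳) (X : Lp ℝ ∞ P) : (X : RV P) ∈ 𝒳 := by
  rcases h with ⟨rfl, -⟩ | h
  · exact X.2
  · exact h.linfty_mem X

theorem IsAmbient.inf_zero_mem (h : IsAmbient P 𝒳) {X : RV P} (hX : X ∈ 𝒳) : X ⊓ 0 ∈ 𝒳 := by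
  rcases h with ⟨rfl, -⟩ | h
  · exact ((⟨X, hX⟩ : Lp ℝ ∞ P) ⊓ 0).2
  · have e : X ⊓ 0 = -((-X) ⊔ 0) := by
      apply AEEqFun.ext
      filter_upwards [AEEqFun.coeFn_inf X 0, AEEqFun.coeFn_sup (-X) 0, AEEqFun.coeFn_neg X,
        AEEqFun.coeFn_neg ((-X) ⊔ 0),
        AEEqFun.coeFn_zero (α := Ω) (β := ℝ) (μ := P)] with ω h1 h2 h3 h4 h5
      rw [h1, h4, Pi.neg_apply, h2, h3, h5, Pi.neg_apply, Pi.zero_apply, neg_sup, neg_neg,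
        neg_zero]
    rw [e]
    exact 𝒳.neg_mem (h.sup_mem (𝒳.neg_mem hX) 𝒳.zero_mem)

/-- In an ambient space, a sequence decreasing almost surely to `X` converges to `X`. -/
theorem IsAmbient.tendsto_of_antitone (h : IsAmbient P 𝒳) {u : ℕ → 𝒳} {X : 𝒳}
    (hu : ∀ᵐ ω ∂P, Antitone fun n => (u n : RV P) ω)
    (hlim : ∀ᵐ ω ∂P, Tendsto (fun n => (u n : RV P) ω) atTop (𝓝 ((X : RV P) ω))) :
    Tendsto u atTop (𝓝 X) := by
  rcases h with ⟨rfl, rfl⟩ | h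
  · rw [nhds_induced, tendsto_comap_iff, tendsto_pi_nhds]
    intro Z
    have hm (Y : Lp.LpSubmodule ℝ ℝ ∞ P) : MemLp ((Y : RV P) : Ω → ℝ) ∞ P :=
      Lp.memLp (⟨Y.1, Y.2⟩ : Lp ℝ ∞ P)
    -- Since `X ≤ u n ≤ u 0`, this dominates the whole sequence.
    have hb : MemLp (fun ω => |((u 0 : RV P) ω)| + |((X : RV P) ω)|) ∞ P :=
      (hm (u 0)).norm.add (hm X).norm
    refine tendsto_integral_of_dominated_convergence
      (fun ω => (|((u 0 : RV P) ω)| + |((X : RV P) ω)|) * |Z ω|)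
      (fun n => (hm (u n)).1.mul (Lp.aestronglyMeasurable Z))
      (hb.integrable_mul (Lp.memLp Z).norm) (fun n => ?_) ?_
    · filter_upwards [hu, hlim] with ω h1 h2
      rw [Real.norm_eq_abs, abs_mul]
      gcongr
      have h3 := h1 (Nat.zero_le n)
      have h4 := h1.le_of_tendsto h2 n
      refine (abs_le_max_abs_abs h4 h3).trans (max_le ?_ ?_)
      · linarith [abs_nonneg ((u 0 : RV P) ω)]
      · linarith [abs_nonneg ((X : RV P) ω)]
    · filter_upwards [hlim] with ω h2
      exact h2.mul_const _
  · have := h.topologicalAddGroup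
    have hsub (n) : ((u n - X : 𝒳) : RV P) =ᵐ[P] fun ω => (u n : RV P) ω - (X : RV P) ω :=
      AEEqFun.coeFn_sub _ _
    have h0 : Tendsto (fun n => u n - X) atTop (𝓝 0) := by
      refine h.sigmaLebesgue _ (fun m n hmn => ?_) ?_
      · rw [← AEEqFun.coeFn_le]
        filter_upwards [hsub m, hsub n, hu] with ω h1 h2 h3
        rw [h1, h2]
        exact sub_le_sub_right (h3 hmn) _
      · filter_upwards [ae_all_iff.2 hsub, hlim] with ω h1 h2
        simp only [h1]
        simpa using h2.sub_const ((X : RV P) ω)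
    simpa using h0.add_const X

variable {𝒜 : Set 𝒳}

/-- Surplus invariance, for the bounded elements and pointwise almost surely. -/
theorem SurplusInvariant.mem_boundedPart (hs : SurplusInvariant 𝒜) (h : IsAmbient P 𝒳)
    {X : 𝒳} (hX : X ∈ 𝒜) {Y : Lp ℝ ∞ P}
    (hYX : ∀ᵐ ω ∂P, max (-(Y ω)) 0 ≤ max (-((X : RV P) ω)) 0) : Y ∈ boundedPart 𝒜 := by
  refine ⟨h.linfty_mem Y, hs X hX _ ?_⟩
  rw [← AEEqFun.coeFn_le]
  filter_upwards [hYX, AEEqFun.coeFn_sup (-(Y : RV P)) 0, AEEqFun.coeFn_sup (-(X : RV P)) 0,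
    AEEqFun.coeFn_neg (Y : RV P), AEEqFun.coeFn_neg (X : RV P),
    AEEqFun.coeFn_zero (α := Ω) (β := ℝ) (μ := P)] with ω h1 h2 h3 h4 h5 h6
  rw [h2, h3, h4, h5, h6]
  exact h1

/-- A closed set contains the decreasing limits of its bounded elements. -/
theorem mem_of_antitone_boundedPart (h : IsAmbient P 𝒳) (hc : IsClosed 𝒜)
    {w : ℕ → Lp ℝ ∞ P} (hw : ∀ n, w n ∈ boundedPart 𝒜) {X : 𝒳}
    (hanti : ∀ᵐ ω ∂P, Antitone fun n => w n ω)
    (hlim : ∀ᵐ ω ∂P, Tendsto (fun n => w n ω) atTop (𝓝 ((X : RV P) ω))) : X ∈ 𝒜 :=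
  hc.mem_of_tendsto
    (h.tendsto_of_antitone (u := fun n => ⟨w n, h.linfty_mem (w n)⟩) hanti hlim)
    (Eventually.of_forall fun n => (hw n).2)

end Ambient

/-! ### Truncation of negative parts. -/

/-- The bounded random variable `-min(X⁻, n)`. -/
noncomputable def truncNegPart {Ω : Type*} [MeasurableSpace Ω] {P : Measure Ω}
    (X : RV P) (n : ℕ) : Lp ℝ ∞ P :=
  MemLp.toLp (fun ω => -min (max (-(X ω)) 0) n) <|
    memLp_top_of_bound
      (by
        have := X.measurable
        exact Measurable.aestronglyMeasurable (by fun_prop)) n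
      (ae_of_all _ fun ω => by
        rw [norm_neg, Real.norm_eq_abs, abs_of_nonneg (by positivity)]
        exact min_le_right _ _)

theorem coeFn_truncNegPart {Ω : Type*} [MeasurableSpace Ω] {P : Measure Ω} (X : RV P) (n : ℕ) :
    truncNegPart X n =ᵐ[P] fun ω => -min (max (-(X ω)) 0) n :=
  MemLp.coeFn_toLp _

theorem tendsto_min_natCast (a : ℝ) : Tendsto (fun n : ℕ => min a (n : ℝ)) atTop (𝓝 a) := by
  obtain ⟨N, hN⟩ := exists_nat_ge a
  refine tendsto_const_nhds.congr' ?_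
  filter_upwards [eventually_ge_atTop N] with n hn
  exact (min_eq_left (hN.trans (by exact_mod_cast hn))).symm

theorem monotone_min_natCast (a : ℝ) : Monotone fun n : ℕ => min a (n : ℝ) :=
  fun m n hmn => min_le_min_left _ (by exact_mod_cast hmn)

/-! ### Tail infima: an increasing sequence below a convergent one, with the same limit. -/

section TailInfimum

variable {a : ℕ → ℝ}

theorem bddBelow_range_tail (ha : ∀ n, 0 ≤ a n) (n : ℕ) :
    BddBelow (Set.range fun m => a (n + m)) :=
  ⟨0, by rintro _ ⟨m, rfl⟩; exact ha _⟩

theorem iInf_tail_le (ha : ∀ n, 0 ≤ a n) (n : ℕ) : ⨅ m, a (n + m) ≤ a n :=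
  ciInf_le (bddBelow_range_tail ha n) 0

theorem monotone_iInf_tail (ha : ∀ n, 0 ≤ a n) : Monotone fun n => ⨅ m, a (n + m) := by
  intro n k hnk
  refine le_ciInf fun m => ?_
  have := ciInf_le (bddBelow_range_tail ha n) (k - n + m)
  rwa [show n + (k - n + m) = k + m by omega] at this

theorem tendsto_iInf_tail (ha : ∀ n, 0 ≤ a n) {l : ℝ} (hl : Tendsto a atTop (𝓝 l)) :
    Tendsto (fun n => ⨅ m, a (n + m)) atTop (𝓝 l) := by
  refine tendsto_order.2 ⟨fun b hb => ?_, fun b hb => ?_⟩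
  · obtain ⟨c, hbc, hcl⟩ := exists_between hb
    obtain ⟨N, hN⟩ := eventually_atTop.1 (hl.eventually_const_lt hcl)
    filter_upwards [eventually_ge_atTop N] with n hn
    exact hbc.trans_le (le_ciInf fun m => (hN _ (by omega)).le)
  · filter_upwards [hl.eventually_lt_const hb] with n hn
    exact (iInf_tail_le ha n).trans_lt hn

end TailInfimum

/-! ### Separation in `L²`. -/

section Representation

variable {Ω : Type*} [MeasurableSpace Ω] {P : Measure Ω} [IsProbabilityMeasure P]
  {𝒳 : Submodule ℝ (RV P)} [TopologicalSpace 𝒳] {𝒜 : Set 𝒳}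

/-- The inclusion of `L^∞` into `L²`. -/
def linftyToL2 (X : Lp ℝ ∞ P) : Lp ℝ 2 P :=
  ⟨(X : RV P), Lp.antitone le_top X.2⟩

omit [TopologicalSpace 𝒳] in
theorem convex_image_linftyToL2 (hconv : Convex ℝ 𝒜) :
    Convex ℝ (linftyToL2 '' boundedPart 𝒜) := by
  rintro _ ⟨X, ⟨hX, hXA⟩, rfl⟩ _ ⟨Y, ⟨hY, hYA⟩, rfl⟩ a b ha hb hab
  exact ⟨a • X + b • Y, ⟨_, hconv hXA hYA ha hb hab⟩, rfl⟩

/-- The nonpositive bounded elements of the `L²`-closure of `𝒜 ∩ L^∞` belong to `𝒜`. -/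
theorem mem_boundedPart_of_mem_closure (h : IsAmbient P 𝒳) (hc : IsClosed 𝒜)
    (hs : SurplusInvariant 𝒜) {Y : Lp ℝ ∞ P} (hY : ∀ᵐ ω ∂P, Y ω ≤ 0)
    (hcl : linftyToL2 Y ∈ closure (linftyToL2 '' boundedPart 𝒜)) : Y ∈ boundedPart 𝒜 := by
  obtain ⟨f, hf, hlim⟩ := mem_closure_iff_seq_limit.1 hcl
  choose X hX hXf using hf
  obtain ⟨ns, -, hns⟩ := (tendstoInMeasure_of_tendsto_Lp hlim).exists_seq_tendsto_ae
  have hns' : ∀ᵐ ω ∂P, Tendsto (fun k => X (ns k) ω) atTop (𝓝 (Y ω)) := by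
    simp only [← hXf] at hns
    exact hns
  let a (k : ℕ) (ω : Ω) : ℝ := max (-(X (ns k) ω)) 0
  have ha (ω : Ω) (k : ℕ) : 0 ≤ a k ω := le_max_right _ _
  have hmeas (k : ℕ) : Measurable (a k) := by
    have := (X (ns k) : RV P).measurable
    fun_prop
  have hmem (n : ℕ) : MemLp (fun ω => -⨅ m, a (n + m) ω) ∞ P := by
    refine (Lp.memLp (X (ns n))).mono
      (Measurable.iInf fun m => hmeas (n + m)).neg.aestronglyMeasurable (ae_of_all _ fun ω => ?_)
    rw [norm_neg, Real.norm_eq_abs, abs_of_nonneg (le_ciInf fun m => ha ω _), Real.norm_eq_abs]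
    exact (iInf_tail_le (ha ω) n).trans (max_le (neg_le_abs _) (abs_nonneg _))
  have hcoe (n : ℕ) : (hmem n).toLp _ =ᵐ[P] fun ω => -⨅ m, a (n + m) ω := (hmem n).coeFn_toLp
  have hcoe' := ae_all_iff.2 hcoe
  -- The `n`-th tail infimum is at most the negative part of `X (ns n)`, so its negative is
  -- acceptable; these negatives decrease to `-Y⁻ = Y`.
  refine ⟨h.linfty_mem Y, mem_of_antitone_boundedPart h hc (w := fun n => (hmem n).toLp _)
    (fun n => ?_) ?_ ?_⟩
  · refine hs.mem_boundedPart h (hX (ns n)).2 ?_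
    filter_upwards [hcoe n] with ω hω
    rw [hω, neg_neg]
    exact max_le (iInf_tail_le (ha ω) n) (ha ω n)
  · filter_upwards [hcoe'] with ω hω
    simp only [hω]
    exact (monotone_iInf_tail (ha ω)).neg
  · filter_upwards [hcoe', hns', hY] with ω hω h1 h2
    simp only [hω]
    have h3 : Tendsto (fun k => a k ω) atTop (𝓝 (max (-(Y ω)) 0)) :=
      h1.neg.max tendsto_const_nhds
    have h4 := (tendsto_iInf_tail (ha ω) h3).neg
    rwa [max_eq_left (by linarith), neg_neg] at h4

/-- A nonpositive bounded random variable outside `𝒜` is strictly separated from `𝒜 ∩ L^∞`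
by an element of `L²`. -/
theorem exists_separating (h : IsAmbient P 𝒳) (hc : IsClosed 𝒜) (hconv : Convex ℝ 𝒜)
    (hs : SurplusInvariant 𝒜) {Y : Lp ℝ ∞ P} (hY : ∀ᵐ ω ∂P, Y ω ≤ 0)
    (hYA : Y ∉ boundedPart 𝒜) :
    ∃ (Z : Lp ℝ 2 P) (c : ℝ), ∫ ω, Y ω * Z ω ∂P < c ∧
      ∀ X ∈ boundedPart 𝒜, c ≤ ∫ ω, X ω * Z ω ∂P := by
  obtain ⟨F, c, h1, h2⟩ := geometric_hahn_banach_point_closed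
    (convex_image_linftyToL2 hconv).closure isClosed_closure
    (fun hcl => hYA (mem_boundedPart_of_mem_closure h hc hs hY hcl))
  have key (X : Lp ℝ ∞ P) : F (linftyToL2 X) =
      ∫ ω, X ω * ((InnerProductSpace.toDual ℝ (Lp ℝ 2 P)).symm F) ω ∂P := by
    rw [← InnerProductSpace.toDual_symm_apply, L2.inner_def]
    rfl
  refine ⟨(InnerProductSpace.toDual ℝ (Lp ℝ 2 P)).symm F, c, ?_, fun X hX => ?_⟩
  · rwa [← key]
  · rw [← key]
    exact (h2 _ (subset_closure ⟨X, hX, rfl⟩)).le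

/-! ### The extended expectation `-E[X⁻ Z]` and the support function. -/

omit [IsProbabilityMeasure P] in
theorem LinftyPos.coeFn_nonneg (Z : LinftyPos P) : ∀ᵐ ω ∂P, 0 ≤ Z.1 ω := by
  filter_upwards [(Lp.coeFn_le _ _).2 Z.2, Lp.coeFn_zero ℝ ∞ P] with ω h1 h2
  rwa [h2] at h1

theorem integrable_linfty_mul (X : Lp ℝ ∞ P) {g : Ω → ℝ} {p : ℝ≥0∞} (hp : 1 ≤ p)
    (hg : MemLp g p P) : Integrable (fun ω => X ω * g ω) P :=
  (Lp.memLp X).integrable_mul (hg.mono_exponent hp)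

theorem integrable_negPart_linfty_mul (X : Lp ℝ ∞ P) {g : Ω → ℝ} {p : ℝ≥0∞} (hp : 1 ≤ p)
    (hg : MemLp g p P) : Integrable (fun ω => max (-(X ω)) 0 * g ω) P :=
  (Lp.memLp X).neg.pos_part.integrable_mul (hg.mono_exponent hp)

/-- For bounded `X`, the extended expectation `-E[X⁻ Z]` is a Bochner integral. -/
theorem negExpectation_linfty (X : Lp ℝ ∞ P) (Z : LinftyPos P) :
    negExpectation (X : RV P) Z = ((-∫ ω, max (-(X ω)) 0 * Z.1 ω ∂P : ℝ) : EReal) := by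
  have hnn : 0 ≤ᵐ[P] fun ω => max (-(X ω)) 0 * Z.1 ω := by
    filter_upwards [Z.coeFn_nonneg] with ω hω
    exact mul_nonneg (le_max_right _ _) hω
  rw [negExpectation, ← ofReal_integral_eq_lintegral_ofReal
    (integrable_negPart_linfty_mul X le_top (Lp.memLp Z.1)) hnn, EReal.coe_ennreal_ofReal,
    max_eq_left (integral_nonneg_of_ae hnn), EReal.coe_neg]

theorem negExpectation_linfty_le (X : Lp ℝ ∞ P) (Z : LinftyPos P) :
    negExpectation (X : RV P) Z ≤ ((∫ ω, X ω * Z.1 ω ∂P : ℝ) : EReal) := by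
  rw [negExpectation_linfty, EReal.coe_le_coe_iff, ← integral_neg]
  refine integral_mono_ae (integrable_negPart_linfty_mul X le_top (Lp.memLp Z.1)).neg
    (integrable_linfty_mul X le_top (Lp.memLp Z.1)) ?_
  filter_upwards [Z.coeFn_nonneg] with ω hω
  rw [← neg_mul]
  exact mul_le_mul_of_nonneg_right (by linarith [le_max_left (-(X ω)) 0]) hω

omit [IsProbabilityMeasure P] in
theorem negExpectation_antitone (X : RV P) : Antitone (negExpectation X) := by
  intro Z W hZW
  refine EReal.neg_le_neg_iff.2 (EReal.coe_ennreal_le_coe_ennreal_iff.2 (lintegral_mono_ae ?_))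
  filter_upwards [(Lp.coeFn_le _ _).2 hZW] with ω hω
  exact ENNReal.ofReal_le_ofReal (mul_le_mul_of_nonneg_left hω (le_max_right _ _))

omit [IsProbabilityMeasure P] in
/-- `-E[X⁻ Z]` decreases when `X` is replaced by a variable with larger negative part. -/
theorem negExpectation_mono {X Y : RV P} (hXY : ∀ᵐ ω ∂P, max (-(Y ω)) 0 ≤ max (-(X ω)) 0)
    (Z : LinftyPos P) : negExpectation X Z ≤ negExpectation Y Z := by
  refine EReal.neg_le_neg_iff.2 (EReal.coe_ennreal_le_coe_ennreal_iff.2 (lintegral_mono_ae ?_))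
  filter_upwards [hXY, Z.coeFn_nonneg] with ω h1 h2
  exact ENNReal.ofReal_le_ofReal (mul_le_mul_of_nonneg_right h1 h2)

omit [IsProbabilityMeasure P] in
theorem negPart_truncNegPart (X : RV P) (n : ℕ) :
    ∀ᵐ ω ∂P, max (-(truncNegPart X n ω)) 0 = min (max (-(X ω)) 0) n := by
  filter_upwards [coeFn_truncNegPart X n] with ω hω
  rw [hω, neg_neg, max_eq_left (by positivity)]

omit [IsProbabilityMeasure P] in
theorem negPart_truncNegPart_le (X : RV P) (n : ℕ) :
    ∀ᵐ ω ∂P, max (-(truncNegPart X n ω)) 0 ≤ max (-(X ω)) 0 := by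
  filter_upwards [negPart_truncNegPart X n] with ω hω
  exact hω ▸ min_le_left _ _

omit [IsProbabilityMeasure P] in
theorem truncNegPart_nonpos (X : RV P) (n : ℕ) : ∀ᵐ ω ∂P, truncNegPart X n ω ≤ 0 := by
  filter_upwards [coeFn_truncNegPart X n] with ω hω
  rw [hω, neg_nonpos]
  positivity

omit [IsProbabilityMeasure P] in
-- Monotone convergence; the limit may be `-∞`.
theorem tendsto_negExpectation_truncNegPart (X : RV P) (Z : LinftyPos P) :
    Tendsto (fun n => negExpectation (truncNegPart X n : RV P) Z) atTop
      (𝓝 (negExpectation X Z)) := by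
  refine (continuous_neg.tendsto _).comp ((continuous_coe_ennreal_ereal.tendsto _).comp ?_)
  have hneg := ae_all_iff.2 (negPart_truncNegPart X)
  refine lintegral_tendsto_of_tendsto_of_monotone (fun n => ?_) ?_ ?_
  · have h1 := (truncNegPart X n : RV P).measurable
    have h2 := (Z.1 : RV P).measurable
    exact Measurable.aemeasurable (by fun_prop)
  · filter_upwards [hneg, Z.coeFn_nonneg] with ω h1 h2 m n hmn
    simp only [h1]
    exact ENNReal.ofReal_le_ofReal
      (mul_le_mul_of_nonneg_right (monotone_min_natCast _ hmn) h2)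
  · filter_upwards [hneg] with ω h1
    simp only [h1]
    exact ENNReal.tendsto_ofReal ((tendsto_min_natCast _).mul_const _)

omit [IsProbabilityMeasure P] in
theorem SurplusInvariant.truncNegPart_mem (hs : SurplusInvariant 𝒜) (h : IsAmbient P 𝒳)
    {X : 𝒳} (hX : X ∈ 𝒜) (n : ℕ) : truncNegPart (X : RV P) n ∈ boundedPart 𝒜 :=
  hs.mem_boundedPart h hX (negPart_truncNegPart_le _ n)

/-- On `L^∞_+` the support function only sees negative parts. -/
theorem lowerSupport_eq_iInf_negExpectation (hs : SurplusInvariant 𝒜) (h : IsAmbient P 𝒳)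
    (Z : LinftyPos P) : lowerSupport (boundedPart 𝒜) Z.toL1 =
      ⨅ X ∈ boundedPart 𝒜, negExpectation (X : RV P) Z := by
  refine le_antisymm (le_iInf₂ fun X hX => ?_)
    (iInf₂_mono fun X _ => negExpectation_linfty_le X Z)
  -- `-X⁻` has the same negative part as `X`, hence competes in the infimum.
  have hm : MemLp (fun ω => -max (-(X ω)) 0) ∞ P := (Lp.memLp X).neg.pos_part.neg
  have hmem : hm.toLp _ ∈ boundedPart 𝒜 := by
    refine hs.mem_boundedPart h hX.2 ?_
    filter_upwards [hm.coeFn_toLp] with ω hω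
    rw [hω, neg_neg, max_eq_left (le_max_right _ _)]
  refine (iInf₂_le _ hmem).trans_eq ?_
  rw [negExpectation_linfty, EReal.coe_eq_coe_iff, ← integral_neg]
  refine integral_congr_ae ?_
  filter_upwards [hm.coeFn_toLp] with ω hω
  rw [← neg_mul, ← hω]
  rfl

/-! ### From `L²` separators to bounded nonnegative ones. -/

/-- The bounded random variable `min(Z⁺, k)`, as an element of `L^∞_+`. -/
noncomputable def truncPosPart (Z : RV P) (k : ℕ) : LinftyPos P :=
  ⟨-truncNegPart (-Z) k, by
    rw [← Lp.coeFn_le]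
    filter_upwards [Lp.coeFn_zero ℝ ∞ P, Lp.coeFn_neg (truncNegPart (-Z) k),
      truncNegPart_nonpos (-Z) k] with ω h1 h2 h3
    rw [h1, h2]
    simpa using h3⟩

omit [IsProbabilityMeasure P] in
theorem coeFn_truncPosPart (Z : RV P) (k : ℕ) :
    (truncPosPart Z k).1 =ᵐ[P] fun ω => min (max (Z ω) 0) k := by
  filter_upwards [Lp.coeFn_neg (truncNegPart (-Z) k), coeFn_truncNegPart (-Z) k,
    AEEqFun.coeFn_neg Z] with ω h1 h2 h3
  rw [truncPosPart, h1, Pi.neg_apply, h2, h3, Pi.neg_apply, neg_neg, neg_neg]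

/-- If `Z ∈ L²` is bounded below on `𝒜 ∩ L^∞` by `c`, so is every truncation `min(Z⁺, k)`. -/
theorem le_lowerSupport_truncPosPart (hs : SurplusInvariant 𝒜) (h : IsAmbient P 𝒳)
    {Z : Lp ℝ 2 P} {c : ℝ} (hZ : ∀ X ∈ boundedPart 𝒜, c ≤ ∫ ω, X ω * Z ω ∂P) (k : ℕ) :
    (c : EReal) ≤ lowerSupport (boundedPart 𝒜) (truncPosPart (Z : RV P) k).toL1 := by
  rw [lowerSupport_eq_iInf_negExpectation hs h]
  refine le_iInf₂ fun X hX => ?_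
  rw [negExpectation_linfty, EReal.coe_le_coe_iff, ← integral_neg]
  have hset : MeasurableSet {ω | 0 < Z ω} :=
    measurableSet_lt measurable_const (Z : RV P).measurable
  -- Test `hZ` on `-1_{Z>0} X⁻`: its integral against `Z` is `-E[X⁻ Z⁺]`, which is at most `-E[X⁻
  -- min(Z⁺, k)]`.
  have hm : MemLp ({ω | 0 < Z ω}.indicator fun ω => -max (-(X ω)) 0) ∞ P :=
    (Lp.memLp X).neg.pos_part.neg.indicator hset
  have hmem : hm.toLp _ ∈ boundedPart 𝒜 := by
    refine hs.mem_boundedPart h hX.2 ?_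
    filter_upwards [hm.coeFn_toLp] with ω hω
    rw [hω, Set.indicator_apply]
    split_ifs <;> simp
  refine (hZ _ hmem).trans (integral_mono_ae
    (integrable_linfty_mul _ one_le_two (Lp.memLp Z))
    (integrable_negPart_linfty_mul X le_top (Lp.memLp _)).neg ?_)
  filter_upwards [hm.coeFn_toLp, coeFn_truncPosPart (Z : RV P) k] with ω h1 h2
  have h3 : 0 ≤ max (-(X ω)) 0 := le_max_right _ _
  rw [h1, h2, Set.indicator_apply]
  split_ifs with hω
  · rw [neg_mul, neg_le_neg_iff]
    exact mul_le_mul_of_nonneg_left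
      ((min_le_left _ _).trans (max_eq_left (le_of_lt hω)).le) h3
  · have h4 : Z ω ≤ 0 := not_lt.1 hω
    rw [max_eq_right h4]
    simp

/-- A bounded nonpositive random variable satisfying all the support inequalities belongs to
`𝒜`. -/
theorem mem_boundedPart_of_lowerSupport_le (h : IsAmbient P 𝒳) (hc : IsClosed 𝒜)
    (hconv : Convex ℝ 𝒜) (hs : SurplusInvariant 𝒜) {Y : Lp ℝ ∞ P} (hY : ∀ᵐ ω ∂P, Y ω ≤ 0)
    (hle : ∀ Z : LinftyPos P,
      lowerSupport (boundedPart 𝒜) Z.toL1 ≤ negExpectation (Y : RV P) Z) :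
    Y ∈ boundedPart 𝒜 := by
  by_contra hYA
  obtain ⟨Z, c, hlt, hge⟩ := exists_separating h hc hconv hs hY hYA
  -- The bound `c` is uniform in `k`, so it passes to the limit `E[Y Z⁺] ≤ E[Y Z] < c`, a
  -- contradiction.
  have hk (k : ℕ) : c ≤ ∫ ω, Y ω * min (max (Z ω) 0) k ∂P := by
    have h1 := ((le_lowerSupport_truncPosPart hs h hge k).trans (hle _)).trans
      (negExpectation_linfty_le _ _)
    rw [EReal.coe_le_coe_iff] at h1
    refine h1.trans_eq (integral_congr_ae ?_)
    filter_upwards [coeFn_truncPosPart (Z : RV P) k] with ω hω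
    rw [hω]
  have hZp : MemLp (fun ω => max (Z ω) 0) 2 P := (Lp.memLp Z).pos_part
  have hlim : Tendsto (fun k : ℕ => ∫ ω, Y ω * min (max (Z ω) 0) k ∂P) atTop
      (𝓝 (∫ ω, Y ω * max (Z ω) 0 ∂P)) := by
    refine tendsto_integral_of_dominated_convergence (fun ω => ‖Y ω * max (Z ω) 0‖)
      (fun k => ?_) (integrable_linfty_mul Y one_le_two hZp).norm
      (fun k => ae_of_all _ fun ω => ?_) (ae_of_all _ fun ω => ?_)
    · have h1 := (Y : RV P).measurable
      have h2 := (Z : RV P).measurable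
      exact Measurable.aestronglyMeasurable (by fun_prop)
    · rw [norm_mul, norm_mul, Real.norm_of_nonneg (le_max_right (Z ω) 0),
        Real.norm_of_nonneg (le_min (le_max_right (Z ω) 0) k.cast_nonneg)]
      gcongr
      exact min_le_left _ _
    · exact (tendsto_min_natCast _).const_mul _
  have hle' : ∫ ω, Y ω * max (Z ω) 0 ∂P ≤ ∫ ω, Y ω * Z ω ∂P := by
    refine integral_mono_ae (integrable_linfty_mul Y one_le_two hZp)
      (integrable_linfty_mul Y one_le_two (Lp.memLp Z)) ?_
    filter_upwards [hY] with ω hω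
    exact mul_le_mul_of_nonpos_left (le_max_left _ _) hω
  exact absurd (ge_of_tendsto' hlim hk) (not_le.2 (hle'.trans_lt hlt))

theorem mem_of_lowerSupport_le (h : IsAmbient P 𝒳) (hc : IsClosed 𝒜)
    (hconv : Convex ℝ 𝒜) (hs : SurplusInvariant 𝒜) {X : 𝒳}
    (hle : ∀ Z : LinftyPos P,
      lowerSupport (boundedPart 𝒜) Z.toL1 ≤ negExpectation (X : RV P) Z) : X ∈ 𝒜 := by
  have hmem (n : ℕ) : truncNegPart (X : RV P) n ∈ boundedPart 𝒜 :=
    mem_boundedPart_of_lowerSupport_le h hc hconv hs (truncNegPart_nonpos _ n) fun Z =>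
      (hle Z).trans (negExpectation_mono (negPart_truncNegPart_le _ n) Z)
  have hcoe := ae_all_iff.2 (coeFn_truncNegPart (X : RV P))
  -- Closedness yields `X ⊓ 0 ∈ 𝒜`; surplus invariance then yields `X`, which has the same negative
  -- part.
  refine hs _ (mem_of_antitone_boundedPart h hc (X := ⟨X ⊓ 0, h.inf_zero_mem X.2⟩) hmem ?_ ?_)
    X ?_
  · filter_upwards [hcoe] with ω hω
    simp only [hω]
    exact (monotone_min_natCast _).neg
  · filter_upwards [hcoe, AEEqFun.coeFn_inf (X : RV P) 0,
      AEEqFun.coeFn_zero (α := Ω) (β := ℝ) (μ := P)] with ω hω h1 h2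
    simp only [hω, h1, h2]
    have h3 := (tendsto_min_natCast (max (-((X : RV P) ω)) 0)).neg
    have h4 : -max (-((X : RV P) ω)) 0 = min ((X : RV P) ω) 0 := by
      rw [neg_sup, neg_neg, neg_zero]
    rwa [h4] at h3
  · rw [← AEEqFun.coeFn_le]
    filter_upwards [AEEqFun.coeFn_sup (-(X : RV P)) 0, AEEqFun.coeFn_sup (-((X : RV P) ⊓ 0)) 0,
      AEEqFun.coeFn_neg (X : RV P), AEEqFun.coeFn_neg ((X : RV P) ⊓ 0),
      AEEqFun.coeFn_inf (X : RV P) 0,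
      AEEqFun.coeFn_zero (α := Ω) (β := ℝ) (μ := P)] with ω h1 h2 h3 h4 h5 h6
    rw [h1, h2, h3, h4, Pi.neg_apply, Pi.neg_apply, h5, h6]
    exact sup_le_sup_right (neg_le_neg inf_le_left) _

theorem isDecreasingFloor_lowerSupport (h : IsAmbient P 𝒳) (hacc : 𝒜.Nonempty)
    (hs : SurplusInvariant 𝒜) :
    IsDecreasingFloor (fun Z : LinftyPos P => lowerSupport (boundedPart 𝒜) Z.toL1) := by
  obtain ⟨X, hX⟩ := hacc
  have hneg (Y : RV P) (Z : LinftyPos P) : negExpectation Y Z ≤ 0 :=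
    EReal.neg_le_zero.2 (EReal.coe_ennreal_nonneg _)
  simp only [lowerSupport_eq_iInf_negExpectation hs h]
  -- Any acceptable bounded element bounds the infimum by `0`; at `Z = 0` every term vanishes, so
  -- the value is finite there.
  refine ⟨fun Z => (iInf₂_le _ (hs.truncNegPart_mem h hX 0)).trans (hneg _ Z), ⟨⟨0, le_rfl⟩, ?_⟩,
    fun Z W hZW => iInf₂_mono fun X _ => negExpectation_antitone _ hZW⟩
  refine (EReal.bot_lt_zero).trans_le (le_iInf₂ fun X _ => ?_)
  rw [negExpectation_linfty, ← EReal.coe_zero, EReal.coe_le_coe_iff,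
    integral_eq_zero_of_ae, neg_zero]
  filter_upwards [Lp.coeFn_zero ℝ ∞ P] with ω hω
  rw [hω]
  simp

theorem represents_lowerSupport (h : IsAmbient P 𝒳) (hc : IsClosed 𝒜)
    (hconv : Convex ℝ 𝒜) (hs : SurplusInvariant 𝒜) :
    Represents (fun Z : LinftyPos P => lowerSupport (boundedPart 𝒜) Z.toL1) 𝒜 := by
  refine Set.Subset.antisymm (fun X hX => Set.mem_iInter.2 fun Z => ?_)
    fun X hX => mem_of_lowerSupport_le h hc hconv hs fun Z => Set.mem_iInter.1 hX Z
  -- `X` itself may be unbounded, so the inequality is proved for its truncations and passed to the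
  -- limit.
  refine ge_of_tendsto' (tendsto_negExpectation_truncNegPart (X : RV P) Z) fun n => ?_
  beta_reduce
  rw [lowerSupport_eq_iInf_negExpectation hs h]
  exact iInf₂_le _ (hs.truncNegPart_mem h hX n)

omit [TopologicalSpace 𝒳] in
theorem Represents.le_lowerSupport {φ : LinftyPos P → EReal} (hφ : Represents φ 𝒜)
    (Z : LinftyPos P) : φ Z ≤ lowerSupport (boundedPart 𝒜) Z.toL1 := by
  refine le_iInf₂ fun X hX => ?_
  have h1 := hX.2
  rw [hφ] at h1
  exact (Set.mem_iInter.1 h1 Z).trans (negExpectation_linfty_le X Z)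

end Representation

theorem mainTheorem3 {Ω : Type*} [MeasurableSpace Ω] (P : Measure Ω) [IsProbabilityMeasure P]
    (𝒳 : Submodule ℝ (RV P)) [TopologicalSpace 𝒳] (h𝒳 : IsAmbient P 𝒳)
    (𝒜 : Set 𝒳) (hacc : IsAcceptanceSet 𝒜) (hclosed : IsClosed 𝒜) (hconv : Convex ℝ 𝒜)
    (hsurplus : SurplusInvariant 𝒜) :
    (∃ φ : LinftyPos P → EReal, IsDecreasingFloor φ ∧ Represents φ 𝒜) ∧
    (IsDecreasingFloor (fun Z : LinftyPos P => lowerSupport (boundedPart 𝒜) Z.toL1) ∧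
      Represents (fun Z : LinftyPos P => lowerSupport (boundedPart 𝒜) Z.toL1) 𝒜) ∧
    (∀ φ : LinftyPos P → EReal, IsDecreasingFloor φ → Represents φ 𝒜 →
      ∀ Z : LinftyPos P, φ Z ≤ lowerSupport (boundedPart 𝒜) Z.toL1) := by
  have hfloor := isDecreasingFloor_lowerSupport h𝒳 hacc.nonempty hsurplus
  have hrep := represents_lowerSupport h𝒳 hclosed hconv hsurplus
  exact ⟨⟨_, hfloor, hrep⟩, ⟨hfloor, hrep⟩, fun φ _ hφ Z => hφ.le_lowerSupport Z⟩
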